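/- For $n\in\mathbb{N}$ and $p\in[0,1]$ let $Q_p^n\subseteq\{0,1\}^n$ be a random subset containing each point of $\{0,1\}^n$ independently with probability $p$, let $P_p=\operatorname{conv}(Q_p^n)\subseteq\mathbb{R}^n$ be the corresponding random $0/1$ polytope, and let $G_p$ be the graph ($1$-skeleton) of $P_p$: its vertices are the vertices of $P_p$, and two distinct vertices $x,y$ are adjacent if and only if the segment $[x,y]$ is a $1$-dimensional face of $P_p$. For a finite graph $G$ let $d(G)=|E(G)|/\binom{|V(G)|}{2}$ be its edge density, with $d(G)=1$ if $|V(G)|\le 1$ (so that $d(G)=1$ exactly when $G$ is a clique). Theorem 1. Fix $\varepsilon>0$ and let $p=p(n)\in[0,1]$ be any sequence. 1. If $p(n)\le\left(\frac{1-\varepsilon}{\sqrt2}\right)^n$ for all sufficiently large $n$, then, with high probability, $d(G_p)=1-o(1)$; that is, there is a sequence $\delta_n\to0$ such that $\Pr\left[\,|1-d(G_{p(n)})|\le\delta_n\right]\to1$ as $n\to\infty$. 2. If $p(n)\ge\left(\frac{1+\varepsilon}{\sqrt2}\right)^n$ for all sufficiently large $n$, then, with high probability, $d(G_p)=o(1)$;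 that is, there is a sequence $\delta_n\to0$ such that $\Pr\left[\,|d(G_{p(n)})|\le\delta_n\right]\to1$ as $n\to\infty$. -/

import Mathlib

/-- `F` is a `k`-face of `P`: a nonempty set of the form `P ∩ H` with `H = {l = c}` and
`P ⊆ {l ≤ c}` for a linear functional `l`, whose affine hull has dimension `k`. As usual,
`P` itself counts as a face of `P` (take `l = 0`). -/
def IsKFace {n : ℕ} (k : ℕ) (P F : Set (Fin n → ℝ)) : Prop :=
  F.Nonempty ∧ IsExposed ℝ P F ∧ Module.finrank ℝ (vectorSpan ℝ F) = k

/-- The set of vertices of a polytope: the points whose singletons are `0`-faces. -/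
def polytopeVertices {n : ℕ} (P : Set (Fin n → ℝ)) : Set (Fin n → ℝ) :=
  {v | IsKFace 0 P {v}}

/-- The graph (`1`-skeleton) of a polytope: two distinct vertices are joined by an edge exactly
when the segment between them is a `1`-face. -/
def polytopeGraph {n : ℕ} (P : Set (Fin n → ℝ)) : SimpleGraph (polytopeVertices P) where
  Adj v w := v ≠ w ∧ IsKFace 1 P (segment ℝ (v : Fin n → ℝ) (w : Fin n → ℝ))
  symm := ⟨fun v w h => ⟨h.1.symm, by rw [segment_symm]; exact h.2⟩⟩
  loopless := ⟨fun _ h => h.1 rfl⟩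

/-- The edge density `|E| / C(|V|, 2)` of a finite graph. A graph with at most one vertex is a
clique and gets density `1`, so that a graph has density `1` if and only if it is a clique. -/
noncomputable def graphDensity {V : Type*} (G : SimpleGraph V) : ℝ :=
  if Nat.card V ≤ 1 then 1 else (G.edgeSet.ncard : ℝ) / ((Nat.card V).choose 2 : ℝ)

/-- The point of `{0,1}ⁿ ⊆ ℝⁿ` with the given bits. -/
def cubePoint {n : ℕ} (b : Fin n → Bool) : Fin n → ℝ :=
  fun i => if b i then 1 else 0

/-- The `0/1` polytope spanned by a set of points of the Boolean cube. -/
def zeroOnePolytope {n : ℕ} (Q : Set (Fin n → Bool)) : Set (Fin n → ℝ) :=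
  convexHull ℝ (cubePoint '' Q)

/-- The law of the random subset of the Boolean cube `{0,1}ⁿ` that contains each point
independently with probability `p`. -/
noncomputable def randomCubeSubset (n : ℕ) (p : unitInterval) :
    MeasureTheory.Measure (Set (Fin n → Bool)) :=
  ProbabilityTheory.setBernoulli Set.univ p

/-! Most pairs `x`, `y` in the cube have Hamming distance close to `n / 2`, so the smallest subcube
containing them has about `√2 ^ n` points. The threshold is where `p` times this size passes from
exponentially small to exponentially large.

Below it, a union bound shows that `Q` rarely contains a third point of that subcube
(`real_subcubeMeets_le`). The subcube is a face of the cube, so in that case the segment is a face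
of the polytope (`isExposed_segment_of_subcube`).

Above it, an edge gives a functional maximal on `Q` at `x` and `y` only. Reflection in the subcube's
centre shows that at least half of the subcube lies on the side that `Q` must avoid, apart from `x`
and `y` (`two_pow_hammingDist_le`). By Sauer–Shelah there are only `2 ^ O(n ^ 2)` such sides, too
few to offset the doubly exponentially small probability of avoiding one
(`real_linearlySeparated_le`).

Either way the expected number of bad ordered pairs is `o(μ ^ 2)` with `μ = p * 2 ^ n`. Markov's
inequality and concentration of `|Q|` turn this into a small proportion of all pairs
(`RandomSubset.real_card_pairs_le`). -/

/-! ### Random subsets: moments and counting of pairs. -/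

open MeasureTheory ProbabilityTheory Filter Topology in
theorem setBernoulli_real_superset_avoid {α : Type*} [Fintype α] [DecidableEq α] (p : unitInterval)
    (S T : Finset α) (h : Disjoint S T) :
    (setBernoulli Set.univ p).real {Q : Set α | (∀ x ∈ S, x ∈ Q) ∧ ∀ x ∈ T, x ∉ Q}
      = (p : ℝ) ^ S.card * (1 - p : ℝ) ^ T.card := by
  have hs : (fun q : α → Prop ↦ {i | q i}) ⁻¹'
      {Q : Set α | (∀ x ∈ S, x ∈ Q) ∧ ∀ x ∈ T, x ∉ Q}
      = Set.pi (↑(S ∪ T)) (fun i => if i ∈ S then {True} else {False}) := by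
    ext q
    simp only [Set.mem_preimage, Set.mem_ofPred_eq, Set.mem_pi, Finset.coe_union, Set.mem_union,
      Finset.mem_coe]
    constructor
    · rintro ⟨h1, h2⟩ i hi
      by_cases hS : i ∈ S
      · simpa [hS] using h1 i hS
      · simpa [hS] using h2 i (hi.resolve_left hS)
    · intro h'
      refine ⟨fun i hi => ?_, fun i hi => ?_⟩
      · simpa [hi] using h' i (Or.inl hi)
      · have := Finset.disjoint_right.1 h hi
        simpa [this] using h' i (Or.inr hi)
  rw [measureReal_def, setBernoulli_apply', hs, Measure.infinitePi_pi _ (fun _ _ => .of_discrete),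
    Finset.prod_union h, ENNReal.toReal_mul, ENNReal.toReal_prod, ENNReal.toReal_prod,
    Finset.prod_congr (g := fun _ => (p : ℝ)) rfl, Finset.prod_congr (s₁ := T)
      (g := fun _ => (1 - p : ℝ)) rfl]
  · simp
  · intro i hi
    have := Finset.disjoint_right.1 h hi
    simp [this, Set.indicator]
  · intro i hi
    simp [hi, Set.indicator]

namespace RandomSubset
open MeasureTheory ProbabilityTheory Filter Topology
open scoped Classical

variable {α : Type*} [Fintype α]

theorem real_mem (p : unitInterval) (x : α) :
    (setBernoulli Set.univ p).real {Q : Set α | x ∈ Q} = p := by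
  simpa using setBernoulli_real_superset_avoid p {x} ∅ (by simp)

theorem real_mem_mem (p : unitInterval) {x y : α} (h : x ≠ y) :
    (setBernoulli Set.univ p).real {Q : Set α | x ∈ Q ∧ y ∈ Q} = (p : ℝ) ^ 2 := by
  simpa [h] using setBernoulli_real_superset_avoid p {x, y} ∅ (by simp)

theorem integral_card_filter {ι : Type*} [Fintype ι] (M : Measure (Set α)) [IsProbabilityMeasure M]
    (R : Set α → ι → Prop) [∀ Q, DecidablePred (R Q)] :
    ∫ Q, ((Finset.univ.filter (R Q)).card : ℝ) ∂M = ∑ q, M.real {Q | R Q q} := by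
  have h1 : ∀ Q, ((Finset.univ.filter (R Q)).card : ℝ)
      = ∑ q, Set.indicator {Q | R Q q} (fun _ => (1 : ℝ)) Q := by
    intro Q
    simp [Set.indicator]
  simp_rw [h1]
  rw [integral_finsetSum _ (fun i _ => .of_finite)]
  refine Finset.sum_congr rfl fun q _ => ?_
  rw [integral_indicator (Set.toFinite _).measurableSet]
  simp

theorem ncard_eq_card_filter (Q : Set α) : Q.ncard = (Finset.univ.filter (· ∈ Q)).card := by
  rw [← Set.ncard_coe_finset]; simp

/-- Chebyshev's inequality: the variance of `Q.ncard` is at most its mean `μ`. -/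
theorem real_ncard_lt_le (p : unitInterval) {μ : ℝ} (hμ : μ = p * Fintype.card α) (h0 : 0 < μ) :
    (setBernoulli Set.univ p).real {Q : Set α | (Q.ncard : ℝ) < μ / 2} ≤ 4 / μ := by
  set M := setBernoulli (Set.univ : Set α) p
  have h1 : ∫ Q, (Q.ncard : ℝ) ∂M = μ := by
    simp_rw [ncard_eq_card_filter]
    rw [integral_card_filter M (fun Q x => x ∈ Q)]
    simp [M, real_mem, hμ, mul_comm]
  have h2 : ∫ Q, (Q.ncard : ℝ) ^ 2 ∂M ≤ μ + μ ^ 2 := by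
    have : ∀ Q : Set α, (Q.ncard : ℝ) ^ 2
        = ((Finset.univ.filter (fun q : α × α => q.1 ∈ Q ∧ q.2 ∈ Q)).card : ℝ) := by
      intro Q
      rw [← Finset.univ_product_univ, Finset.filter_product (· ∈ Q) (· ∈ Q), Finset.card_product,
        ncard_eq_card_filter]
      push_cast; ring
    simp_rw [this]
    rw [integral_card_filter M (fun Q (q : α × α) => q.1 ∈ Q ∧ q.2 ∈ Q), Fintype.sum_prod_type]
    have hb : ∀ x y : α, M.real {Q | x ∈ Q ∧ y ∈ Q} ≤ (if x = y then (p : ℝ) else 0) + p ^ 2 := by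
      intro x y
      split_ifs with h
      · subst h
        simp only [and_self]
        rw [real_mem]
        have := sq_nonneg (p : ℝ)
        linarith
      · rw [real_mem_mem p h]; simp
    calc _ ≤ ∑ x : α, ∑ y : α, ((if x = y then (p : ℝ) else 0) + p ^ 2) :=
          Finset.sum_le_sum fun x _ => Finset.sum_le_sum fun y _ => hb x y
      _ = μ + μ ^ 2 := by
          simp [Finset.sum_add_distrib, hμ]; ring
  have h3 : ∫ Q, ((Q.ncard : ℝ) - μ) ^ 2 ∂M ≤ μ := by
    have : ∀ Q : Set α, ((Q.ncard : ℝ) - μ) ^ 2 = (Q.ncard : ℝ) ^ 2 - 2 * μ * Q.ncard + μ ^ 2 := by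
      intro Q; ring
    simp_rw [this]
    rw [integral_add .of_finite .of_finite, integral_sub .of_finite .of_finite,
      integral_const_mul, h1]
    simp
    nlinarith
  have h4 := mul_meas_ge_le_integral_of_nonneg (μ := M) (f := fun Q => ((Q.ncard : ℝ) - μ) ^ 2)
    (ae_of_all _ fun Q => sq_nonneg _) .of_finite ((μ / 2) ^ 2)
  have h5 : M.real {Q : Set α | (Q.ncard : ℝ) < μ / 2}
      ≤ M.real {Q : Set α | (μ / 2) ^ 2 ≤ ((Q.ncard : ℝ) - μ) ^ 2} := by
    refine measureReal_mono fun Q hQ => ?_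
    simp only [Set.mem_ofPred_eq] at hQ ⊢
    nlinarith
  rw [le_div_iff₀ h0]
  have h6 := h4.trans h3
  have h7 : μ * (M.real {Q : Set α | (μ / 2) ^ 2 ≤ ((Q.ncard : ℝ) - μ) ^ 2} * μ) ≤ μ * 4 := by
    change _ * M.real _ ≤ _ at h6
    nlinarith
  have h8 := le_of_mul_le_mul_left h7 h0
  nlinarith

/-- The ordered pairs of distinct points of `Q` satisfying `R Q`. -/
noncomputable def pairs (R : Set α → α → α → Prop) (Q : Set α) : Finset (α × α) :=
  Finset.univ.filter fun q => q.1 ∈ Q ∧ q.2 ∈ Q ∧ q.1 ≠ q.2 ∧ R Q q.1 q.2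

/-- No lower bound on `μ` is assumed, so `Q.ncard` need not concentrate. If `μ` is at most `1 / θ`,
the expected number of bad pairs is so small that usually there are none; otherwise `μ` is large
enough for Chebyshev. -/
theorem real_card_pairs_le (p : unitInterval) (R : Set α → α → α → Prop) {μ θ : ℝ}
    (hμ : μ = p * Fintype.card α) (hθ : 0 ≤ θ) (hθ' : θ ≤ 1 / 4)
    (hE : ∑ q : α × α, (setBernoulli Set.univ p).real
      {Q : Set α | q.1 ∈ Q ∧ q.2 ∈ Q ∧ q.1 ≠ q.2 ∧ R Q q.1 q.2} ≤ θ ^ 4 * μ ^ 2) :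
    1 - (4 * θ + θ ^ 2) ≤ (setBernoulli Set.univ p).real
      {Q : Set α | ((pairs R Q).card : ℝ) ≤ 8 * θ ^ 2 * (Q.ncard * (Q.ncard - 1))} := by
  set M := setBernoulli (Set.univ : Set α) p
  have hμ0 : 0 ≤ μ := by rw [hμ]; exact mul_nonneg p.2.1 (by positivity)
  have hI : ∫ Q, ((pairs R Q).card : ℝ) ∂M ≤ θ ^ 4 * μ ^ 2 :=
    (integral_card_filter M _).trans_le hE
  have markov : ∀ t : ℝ, t * M.real {Q | t ≤ ((pairs R Q).card : ℝ)} ≤ θ ^ 4 * μ ^ 2 := fun t =>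
    (mul_meas_ge_le_integral_of_nonneg (ae_of_all _ fun Q => by positivity) .of_finite t).trans hI
  have hmeas : ∀ s : Set (Set α), MeasurableSet s := fun s => (Set.toFinite s).measurableSet
  suffices h : M.real {Q : Set α | ((pairs R Q).card : ℝ) ≤ 8 * θ ^ 2 * (Q.ncard * (Q.ncard - 1))}ᶜ
      ≤ 4 * θ + θ ^ 2 by
    rw [probReal_compl_eq_one_sub (hmeas _)] at h
    linarith
  by_cases hc : θ * μ ≤ 1
  · have h1 := markov 1
    have h2 : θ ^ 4 * μ ^ 2 ≤ θ ^ 2 := by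
      have : (θ * μ) ^ 2 ≤ 1 := by
        have : 0 ≤ θ * μ := by positivity
        nlinarith
      calc θ ^ 4 * μ ^ 2 = θ ^ 2 * (θ * μ) ^ 2 := by ring
        _ ≤ θ ^ 2 * 1 := by gcongr
        _ = _ := by ring
    refine (measureReal_mono (s₂ := {Q | (1 : ℝ) ≤ ((pairs R Q).card : ℝ)}) fun Q hQ => ?_).trans
      (by linarith)
    simp only [Set.mem_compl_iff, Set.mem_ofPred_eq, not_le] at hQ ⊢
    by_contra hlt
    have h0 : (pairs R Q).card = 0 := by
      have : ((pairs R Q).card : ℝ) < 1 := not_le.1 hlt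
      exact_mod_cast Nat.lt_one_iff.1 (by exact_mod_cast this)
    rw [h0] at hQ
    have : (0 : ℝ) ≤ Q.ncard * (Q.ncard - 1) := by
      rcases Nat.eq_zero_or_pos Q.ncard with h | h
      · simp [h]
      · have : (1 : ℝ) ≤ Q.ncard := by exact_mod_cast h
        exact mul_nonneg (by positivity) (by linarith)
    have := mul_nonneg (by positivity : 0 ≤ 8 * θ ^ 2) this
    push_cast at hQ
    linarith
  · push Not at hc
    have hθp : 0 < θ := by
      rcases hθ.eq_or_lt with h | h
      · rw [← h] at hc; norm_num at hc
      · exact h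
    -- This makes `Q.ncard ≥ μ / 2` imply `Q.ncard - 1 ≥ μ / 4`, whence the bound `μ ^ 2 / 8` below
    -- and the factor `8` in the conclusion.
    have hμ4 : 4 < μ := by nlinarith
    have hμp : 0 < μ := by linarith
    have h1 := markov (θ ^ 2 * μ ^ 2)
    have h1' : M.real {Q | θ ^ 2 * μ ^ 2 ≤ ((pairs R Q).card : ℝ)} ≤ θ ^ 2 := by
      refine le_of_mul_le_mul_left (h1.trans_eq ?_) (by positivity : 0 < θ ^ 2 * μ ^ 2)
      ring
    have h2 := real_ncard_lt_le p hμ hμp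
    have h2' : 4 / μ ≤ 4 * θ := by
      rw [div_le_iff₀ hμp]; nlinarith
    refine (measureReal_mono (s₂ := {Q : Set α | (Q.ncard : ℝ) < μ / 2} ∪
      {Q | θ ^ 2 * μ ^ 2 ≤ ((pairs R Q).card : ℝ)}) fun Q hQ => ?_).trans
        ((measureReal_union_le _ _).trans (by linarith))
    simp only [Set.mem_compl_iff, Set.mem_ofPred_eq, not_le, Set.mem_union] at hQ ⊢
    by_contra! hcon
    obtain ⟨ha, hb⟩ := hcon
    have : μ ^ 2 / 8 ≤ Q.ncard * ((Q.ncard : ℝ) - 1) := by nlinarith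
    have := mul_le_mul_of_nonneg_left this (by positivity : 0 ≤ 8 * θ ^ 2)
    linarith

end RandomSubset

/-! ### Vertices and edges of 0/1 polytopes. -/

theorem cubePoint_injective {n : ℕ} : Function.Injective (cubePoint (n := n)) := by
  intro b c h
  funext i
  have := congrFun h i
  unfold cubePoint at this
  cases hb : b i <;> cases hc : c i <;> simp [hb, hc] at this ⊢

/-- The linear functional with coefficient `±1` (matching the bits of `b`) at each coordinate
where `b` and `c` agree and `0` elsewhere. -/
noncomputable def agreeFunctional {n : ℕ} (b c : Fin n → Bool) : StrongDual ℝ (Fin n → ℝ) :=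
  ∑ i, (if b i = c i then (if b i then 1 else -1) else (0 : ℝ)) • ContinuousLinearMap.proj i

theorem agreeFunctional_apply {n : ℕ} (b c : Fin n → Bool) (x : Fin n → ℝ) :
    agreeFunctional b c x = ∑ i, (if b i = c i then (if b i then 1 else -1) else 0) * x i := by
  simp only [agreeFunctional, sum_apply, smul_apply,
    ContinuousLinearMap.proj_apply, smul_eq_mul]

theorem agreeFunctional_cubePoint_le {n : ℕ} (b c z : Fin n → Bool) :
    agreeFunctional b c (cubePoint z) ≤ agreeFunctional b c (cubePoint b) := by
  simp only [agreeFunctional_apply]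
  refine Finset.sum_le_sum fun i _ => ?_
  unfold cubePoint
  cases b i <;> cases c i <;> cases z i <;> simp

theorem agreeFunctional_cubePoint_eq_iff {n : ℕ} (b c z : Fin n → Bool) :
    agreeFunctional b c (cubePoint z) = agreeFunctional b c (cubePoint b) ↔
      ∀ i, b i = c i → z i = b i := by
  simp only [agreeFunctional_apply]
  rw [Finset.sum_eq_sum_iff_of_le]
  · simp only [Finset.mem_univ, forall_const]
    refine forall_congr' fun i => ?_
    unfold cubePoint
    cases b i <;> cases c i <;> cases z i <;> simp
  · intro i _
    unfold cubePoint
    cases b i <;> cases c i <;> cases z i <;> simp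

theorem le_of_mem_convexHull {E : Type*} [AddCommGroup E] [Module ℝ E] [TopologicalSpace E]
    {s : Set E} (l : StrongDual ℝ E) {m : ℝ} (h : ∀ x ∈ s, l x ≤ m) {x : E}
    (hx : x ∈ convexHull ℝ s) : l x ≤ m :=
  convexHull_min (t := {x | l x ≤ m}) h (convex_halfSpace_le l.toLinearMap.isLinear m) hx

/-- A point of the hull of the union is a convex combination of a point of each hull; any positive
weight on the `t` side would push `l` strictly below `m`. -/
theorem mem_convexHull_of_eq_max {E : Type*} [AddCommGroup E] [Module ℝ E] [TopologicalSpace E]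
    {s t : Set E} (l : StrongDual ℝ E) {m : ℝ} (hs : s.Nonempty) (h : ∀ x ∈ s, l x = m)
    (ht : ∀ x ∈ t, l x < m) {x : E} (hx : x ∈ convexHull ℝ (s ∪ t)) (hm : l x = m) :
    x ∈ convexHull ℝ s := by
  rcases t.eq_empty_or_nonempty with rfl | hne
  · simpa using hx
  rw [convexHull_union hs hne, mem_convexJoin] at hx
  obtain ⟨a, ha, b, hb, u, v, hu, hv, huv, rfl⟩ := hx
  have h1 : l a ≤ m := le_of_mem_convexHull l (fun x hx => (h x hx).le) ha
  have h2 : l b < m :=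
    convexHull_min (t := {x | l x < m}) ht (convex_halfSpace_lt l.toLinearMap.isLinear m) hb
  simp only [map_add, map_smul, smul_eq_mul] at hm
  have hv0 : v = 0 := by
    by_contra hne
    have hvp : 0 < v := lt_of_le_of_ne hv (Ne.symm hne)
    have : u * l a ≤ u * m := mul_le_mul_of_nonneg_left h1 hu
    have : v * l b < v * m := mul_lt_mul_of_pos_left h2 hvp
    have : u * m + v * m = m := by rw [← add_mul, huv, one_mul]
    linarith
  subst hv0
  have : u = 1 := by linarith
  subst this
  simpa using ha

/-- The points of the smallest subcube containing `b` and `c`. -/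
def subcube {n : ℕ} (b c : Fin n → Bool) : Set (Fin n → Bool) :=
  {z | ∀ i, b i = c i → z i = b i}

/-- `agreeFunctional b c` attains its maximum over the cube exactly on `subcube b c`, where `b` and
`c` are the only points of `Q`. The case `b = c` is allowed and yields the vertices. -/
theorem isExposed_segment_of_subcube {n : ℕ} {Q : Set (Fin n → Bool)} {b c : Fin n → Bool}
    (hb : b ∈ Q) (hc : c ∈ Q) (h : ∀ z ∈ Q, z ∈ subcube b c → z = b ∨ z = c) :
    IsExposed ℝ (zeroOnePolytope Q) (segment ℝ (cubePoint b) (cubePoint c)) := by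
  intro _
  refine ⟨agreeFunctional b c, ?_⟩
  set l := agreeFunctional b c
  set m := l (cubePoint b)
  have hmax : ∀ x ∈ zeroOnePolytope Q, l x ≤ m := fun x hx => by
    refine le_of_mem_convexHull l ?_ hx
    rintro _ ⟨z, _, rfl⟩
    exact agreeFunctional_cubePoint_le b c z
  have hbP : cubePoint b ∈ zeroOnePolytope Q := subset_convexHull ℝ _ ⟨b, hb, rfl⟩
  have hcP : cubePoint c ∈ zeroOnePolytope Q := subset_convexHull ℝ _ ⟨c, hc, rfl⟩
  have hlc : l (cubePoint c) = m :=
    (agreeFunctional_cubePoint_eq_iff b c c).2 fun i hi => hi.symm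
  ext x
  constructor
  · intro hx
    refine ⟨(convex_convexHull ℝ _).segment_subset hbP hcP hx, fun y hy => (hmax y hy).trans ?_⟩
    obtain ⟨u, v, -, -, huv, rfl⟩ := hx
    simp only [map_add, map_smul, smul_eq_mul, hlc]
    change m ≤ u * m + v * m
    rw [← add_mul, huv, one_mul]
  · rintro ⟨hx, hx'⟩
    have hm : l x = m := le_antisymm (hmax x hx) (hx' _ hbP)
    rw [← convexHull_pair]
    refine mem_convexHull_of_eq_max (t := cubePoint '' (Q \ {b, c})) l (Set.insert_nonempty _ _)
      (by simpa using ⟨rfl, hlc⟩) ?_ ?_ hm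
    · rintro _ ⟨z, ⟨hz, hz'⟩, rfl⟩
      refine lt_of_le_of_ne (agreeFunctional_cubePoint_le b c z) fun heq => hz' ?_
      exact h z hz ((agreeFunctional_cubePoint_eq_iff b c z).1 heq)
    · refine convexHull_mono ?_ hx
      rintro _ ⟨z, hz, rfl⟩
      by_cases hz' : z ∈ ({b, c} : Set _)
      · rcases hz' with rfl | rfl <;> simp
      · exact Or.inr ⟨z, ⟨hz, hz'⟩, rfl⟩

theorem polytopeVertices_zeroOnePolytope {n : ℕ} (Q : Set (Fin n → Bool)) :
    polytopeVertices (zeroOnePolytope Q) = cubePoint '' Q := by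
  ext v
  constructor
  · rintro ⟨-, hv, -⟩
    have : v ∈ (zeroOnePolytope Q).extremePoints ℝ := by
      rw [← isExtreme_singleton]
      exact hv.isExtreme
    exact extremePoints_convexHull_subset this
  · rintro ⟨b, hb, rfl⟩
    refine ⟨Set.singleton_nonempty _, ?_, by simp⟩
    have := isExposed_segment_of_subcube hb hb (fun z _ hz => Or.inl (funext fun i => hz i rfl))
    rwa [segment_same] at this

theorem isKFace_one_segment_of_subcube {n : ℕ} {Q : Set (Fin n → Bool)} {b c : Fin n → Bool}
    (hb : b ∈ Q) (hc : c ∈ Q) (hbc : b ≠ c) (h : ∀ z ∈ Q, z ∈ subcube b c → z = b ∨ z = c) :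
    IsKFace 1 (zeroOnePolytope Q) (segment ℝ (cubePoint b) (cubePoint c)) := by
  refine ⟨⟨_, left_mem_segment ℝ _ _⟩, isExposed_segment_of_subcube hb hc h, ?_⟩
  rw [vectorSpan_segment]
  exact finrank_span_singleton (sub_ne_zero.2 fun h => hbc (cubePoint_injective h.symm))

/-- A point of `Q` attaining the maximum of the exposing functional lies on the segment; being a
vertex, hence extreme, it must be an endpoint. -/
theorem exists_functional_of_isExposed_segment {n : ℕ} {Q : Set (Fin n → Bool)}
    {b c : Fin n → Bool}
    (h : IsExposed ℝ (zeroOnePolytope Q) (segment ℝ (cubePoint b) (cubePoint c))) :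
    ∃ l : StrongDual ℝ (Fin n → ℝ), l (cubePoint b) = l (cubePoint c) ∧
      ∀ z ∈ Q, z ≠ b → z ≠ c → l (cubePoint z) < l (cubePoint b) := by
  obtain ⟨l, hl⟩ := h ⟨_, left_mem_segment ℝ _ _⟩
  have hb : cubePoint b ∈ segment ℝ (cubePoint b) (cubePoint c) := left_mem_segment ℝ _ _
  have hc : cubePoint c ∈ segment ℝ (cubePoint b) (cubePoint c) := right_mem_segment ℝ _ _
  have hb' := hb
  have hc' := hc
  rw [hl] at hb' hc'
  refine ⟨l, le_antisymm (hc'.2 _ hb'.1) (hb'.2 _ hc'.1), fun z hz hzb hzc => ?_⟩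
  have hzP : cubePoint z ∈ zeroOnePolytope Q := subset_convexHull ℝ _ ⟨z, hz, rfl⟩
  refine lt_of_le_of_ne (hb'.2 _ hzP) fun heq => ?_
  have hzs : cubePoint z ∈ segment ℝ (cubePoint b) (cubePoint c) := by
    rw [hl]
    exact ⟨hzP, fun y hy => heq ▸ hb'.2 y hy⟩
  have hzv : cubePoint z ∈ polytopeVertices (zeroOnePolytope Q) :=
    (polytopeVertices_zeroOnePolytope Q).ge ⟨z, hz, rfl⟩
  have hext : cubePoint z ∈ (zeroOnePolytope Q).extremePoints ℝ := by
    rw [← isExtreme_singleton]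
    exact hzv.2.1.isExtreme
  rcases (mem_extremePoints_iff_forall_segment.1 hext).2 _ hb'.1 _ hc'.1 hzs with h | h
  · exact hzb (cubePoint_injective h.symm)
  · exact hzc (cubePoint_injective h.symm)

/-! ### Edge density in terms of ordered pairs of points of `Q`. -/

theorem card_filter_adj {V : Type*} [Fintype V] [DecidableEq V] (G : SimpleGraph V)
    [DecidableRel G.Adj] :
    (Finset.univ.filter fun q : V × V => G.Adj q.1 q.2).card = 2 * G.edgeSet.ncard := by
  rw [← G.coe_edgeFinset, Set.ncard_coe_finset, ← G.dart_card_eq_twice_card_edges,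
    ← Fintype.card_subtype]
  refine Fintype.card_congr ⟨fun q => ⟨q.1, q.2⟩, fun d => ⟨d.1, d.2⟩, fun _ => rfl, fun _ => rfl⟩

open scoped Classical in
theorem graphDensity_eq {V : Type*} [Fintype V] (G : SimpleGraph V) (h : 1 < Nat.card V) :
    graphDensity G = ((Finset.univ.filter fun q : V × V => G.Adj q.1 q.2).card : ℝ) /
      (Nat.card V * ((Nat.card V : ℝ) - 1)) := by
  rw [graphDensity, if_neg (not_le.2 h), card_filter_adj G, Nat.cast_choose_two]
  push_cast
  rw [div_div_eq_mul_div, mul_comm]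

open scoped Classical in
theorem one_sub_graphDensity_eq {V : Type*} [Fintype V] (G : SimpleGraph V) (h : 1 < Nat.card V) :
    1 - graphDensity G =
      ((Finset.univ.filter fun q : V × V => q.1 ≠ q.2 ∧ ¬ G.Adj q.1 q.2).card : ℝ) /
        (Nat.card V * ((Nat.card V : ℝ) - 1)) := by
  have h1 : (1 : ℝ) < Nat.card V := by exact_mod_cast h
  have hpos : 0 < (Nat.card V : ℝ) * ((Nat.card V : ℝ) - 1) :=
    mul_pos (by linarith) (by linarith)
  rw [graphDensity_eq G h, eq_div_iff hpos.ne', sub_mul, div_mul_cancel₀ _ hpos.ne', one_mul,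
    sub_eq_iff_eq_add, ← Nat.cast_add, ← Finset.card_union_of_disjoint]
  · have : (Finset.univ.filter fun q : V × V => q.1 ≠ q.2 ∧ ¬ G.Adj q.1 q.2) ∪
        (Finset.univ.filter fun q : V × V => G.Adj q.1 q.2) = (Finset.univ : Finset V).offDiag := by
      ext q
      simp only [Finset.mem_union, Finset.mem_filter, Finset.mem_univ, true_and,
        Finset.mem_offDiag]
      constructor
      · rintro (h | h)
        · exact h.1
        · exact h.ne
      · intro h
        by_cases h' : G.Adj q.1 q.2
        · exact Or.inr h'
        · exact Or.inl ⟨h, h'⟩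
    rw [this, Finset.offDiag_card, Nat.cast_sub (Nat.le_mul_self _)]
    simp [Nat.card_eq_fintype_card]
    ring
  · rw [Finset.disjoint_left]
    simp +contextual

open scoped Classical in
/-- Pairs of vertices of the polytope of `Q` satisfying `S` are counted by pairs in `Q`
satisfying `R`. -/
theorem card_vertex_pairs_le {n : ℕ} (Q : Set (Fin n → Bool))
    (R : Set (Fin n → Bool) → (Fin n → Bool) → (Fin n → Bool) → Prop)
    [Fintype (polytopeVertices (zeroOnePolytope Q))]
    (S : polytopeVertices (zeroOnePolytope Q) → polytopeVertices (zeroOnePolytope Q) → Prop)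
    (hS : ∀ v w, S v w → v ≠ w ∧ ∀ b ∈ Q, ∀ c ∈ Q, cubePoint b = v → cubePoint c = w → R Q b c) :
    (Finset.univ.filter fun q : _ × _ => S q.1 q.2).card ≤ (RandomSubset.pairs R Q).card := by
  have hex : ∀ v : polytopeVertices (zeroOnePolytope Q), ∃ b, b ∈ Q ∧ cubePoint b = (v : _) := fun v =>
    (polytopeVertices_zeroOnePolytope Q).le v.2
  choose f hf hf' using hex
  have hinj : Function.Injective f := fun v w h => by
    apply Subtype.ext
    rw [← hf', ← hf', h]
  refine Finset.card_le_card_of_injOn (fun q => (f q.1, f q.2)) ?_ ?_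
  · intro q hq
    have hq' : S q.1 q.2 := by simpa using hq
    simp only [RandomSubset.pairs, Finset.coe_filter, Finset.mem_univ, true_and, Set.mem_ofPred_eq]
    exact ⟨hf _, hf _, hinj.ne (hS _ _ hq').1, (hS _ _ hq').2 _ (hf _) _ (hf _) (hf' _) (hf' _)⟩
  · intro q _ q' _ h
    simp only [Prod.mk.injEq] at h
    exact Prod.ext (hinj h.1) (hinj h.2)

theorem natCard_polytopeVertices {n : ℕ} (Q : Set (Fin n → Bool)) :
    Nat.card (polytopeVertices (zeroOnePolytope Q)) = Q.ncard := by
  rw [Nat.card_coe_set_eq, polytopeVertices_zeroOnePolytope,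
    Set.ncard_image_of_injective _ cubePoint_injective]

theorem finite_polytopeVertices {n : ℕ} (Q : Set (Fin n → Bool)) :
    Finite (polytopeVertices (zeroOnePolytope Q)) := by
  rw [polytopeVertices_zeroOnePolytope]
  exact (Set.toFinite Q).image _

/-- Some point of `Q` other than `b`, `c` lies in the subcube of `b` and `c`. -/
def SubcubeMeets {n : ℕ} (Q : Set (Fin n → Bool)) (b c : Fin n → Bool) : Prop :=
  ∃ z, z ≠ b ∧ z ≠ c ∧ z ∈ subcube b c ∧ z ∈ Q

/-- Some linear functional is maximal on `Q` at `b` and `c` only. -/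
def LinearlySeparated {n : ℕ} (Q : Set (Fin n → Bool)) (b c : Fin n → Bool) : Prop :=
  ∃ l : StrongDual ℝ (Fin n → ℝ), l (cubePoint b) = l (cubePoint c) ∧
      ∀ z ∈ Q, z ≠ b → z ≠ c → l (cubePoint z) < l (cubePoint b)

theorem abs_one_sub_graphDensity_le {n : ℕ} {Q : Set (Fin n → Bool)} {δ : ℝ} (hδ : 0 ≤ δ)
    (h : ((RandomSubset.pairs SubcubeMeets Q).card : ℝ) ≤ δ * (Q.ncard * (Q.ncard - 1))) :
    |1 - graphDensity (polytopeGraph (zeroOnePolytope Q))| ≤ δ := by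
  classical
  have := finite_polytopeVertices Q
  have := Fintype.ofFinite (polytopeVertices (zeroOnePolytope Q))
  by_cases hc : Nat.card (polytopeVertices (zeroOnePolytope Q)) ≤ 1
  · rw [graphDensity, if_pos hc]; simpa using hδ
  push Not at hc
  have h1 : (1 : ℝ) < Nat.card (polytopeVertices (zeroOnePolytope Q)) := by exact_mod_cast hc
  have hpos := mul_pos (zero_lt_one.trans h1) (sub_pos.2 h1)
  rw [one_sub_graphDensity_eq _ hc, abs_of_nonneg (by positivity), div_le_iff₀ hpos,
    natCard_polytopeVertices]
  refine le_trans ?_ h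
  have key := card_vertex_pairs_le Q SubcubeMeets
    (fun v w => v ≠ w ∧ ¬ (polytopeGraph (zeroOnePolytope Q)).Adj v w) (by
      rintro v w ⟨hvw, hadj⟩
      refine ⟨hvw, fun b hb c hc hbv hcw => ?_⟩
      by_contra hR
      refine hadj ⟨hvw, ?_⟩
      rw [← hbv, ← hcw]
      refine isKFace_one_segment_of_subcube hb hc ?_ fun z hz hz' => ?_
      · rintro rfl
        exact hvw (Subtype.ext (hbv.symm.trans hcw))
      · by_contra! hne
        exact hR ⟨z, hne.1, hne.2, hz', hz⟩)
  exact_mod_cast key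

theorem abs_graphDensity_le {n : ℕ} {Q : Set (Fin n → Bool)} {δ : ℝ} (hQ : 1 < Q.ncard)
    (h : ((RandomSubset.pairs LinearlySeparated Q).card : ℝ) ≤ δ * (Q.ncard * (Q.ncard - 1))) :
    |graphDensity (polytopeGraph (zeroOnePolytope Q))| ≤ δ := by
  classical
  have := finite_polytopeVertices Q
  have := Fintype.ofFinite (polytopeVertices (zeroOnePolytope Q))
  have hc := hQ
  rw [← natCard_polytopeVertices] at hc
  have h1 : (1 : ℝ) < Nat.card (polytopeVertices (zeroOnePolytope Q)) := by exact_mod_cast hc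
  have hpos := mul_pos (zero_lt_one.trans h1) (sub_pos.2 h1)
  rw [graphDensity_eq _ hc, abs_of_nonneg (by positivity), div_le_iff₀ hpos,
    natCard_polytopeVertices]
  refine le_trans ?_ h
  have key := card_vertex_pairs_le Q LinearlySeparated
    (fun v w => (polytopeGraph (zeroOnePolytope Q)).Adj v w) (by
      rintro v w ⟨hvw, hadj⟩
      refine ⟨hvw, fun b hb c hc hbv hcw => ?_⟩
      rw [← hbv, ← hcw] at hadj
      exact exists_functional_of_isExposed_segment hadj.2.1)
  exact_mod_cast key

/-! ### Counting half-space traces by VC dimension. -/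

/-- The traces on the cube of the open half-spaces bounded by a hyperplane through
`cubePoint x`. -/
noncomputable def halfspaceTraces {n : ℕ} (x : Fin n → Bool) : Finset (Finset (Fin n → Bool)) :=
  open scoped Classical in
  Finset.univ.filter fun A => ∃ l : StrongDual ℝ (Fin n → ℝ),
    ∀ z, z ∈ A ↔ l (cubePoint z) < l (cubePoint x)

-- More than `n` vectors `z - x` are linearly dependent. If `l` is negative on them exactly where
-- the coefficient is positive, every term of the relation becomes nonpositive after applying `l`,
-- and one is negative, although they sum to zero.
open scoped Classical in
theorem card_le_of_shatters_halfspaceTraces {n : ℕ} {x : Fin n → Bool}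
    {s : Finset (Fin n → Bool)} (h : (halfspaceTraces x).Shatters s) : s.card ≤ n := by
  by_contra! hlt
  have hdep : ¬ LinearIndependent ℝ (fun z : s => cubePoint z.1 - cubePoint x) := fun hli => by
    have := hli.fintype_card_le_finrank
    simp at this
    omega
  rw [Fintype.not_linearIndependent_iff] at hdep
  -- Changing the sign of the relation if necessary provides the term that will be strictly
  -- negative.
  have hpos : ∃ g : s → ℝ, ∑ i, g i • (cubePoint i.1 - cubePoint x) = 0 ∧ ∃ i, 0 < g i := by
    obtain ⟨g, hg, i, hi⟩ := hdep
    rcases hi.lt_or_gt with hi | hi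
    · exact ⟨-g, by simp only [Pi.neg_apply, neg_smul, Finset.sum_neg_distrib, hg, neg_zero], i, by simpa using hi⟩
    · exact ⟨g, hg, i, hi⟩
  obtain ⟨g, hg, i, hi⟩ := hpos
  obtain ⟨u, hu, hsu⟩ := h (t := s.filter fun z => ∃ hz : z ∈ s, 0 < g ⟨z, hz⟩)
    (Finset.filter_subset _ _)
  obtain ⟨l, hl⟩ := (Finset.mem_filter.1 hu).2
  have hiff : ∀ z : s, l (cubePoint z.1) < l (cubePoint x) ↔ 0 < g z := by
    intro z
    rw [← hl]
    have : z.1 ∈ s ∩ u ↔ z.1 ∈ s.filter fun z => ∃ hz : z ∈ s, 0 < g ⟨z, hz⟩ := by rw [hsu]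
    simpa [z.2] using this
  have h0 : ∑ i, g i * (l (cubePoint i.1) - l (cubePoint x)) = 0 := by
    have := congrArg l hg
    simpa using this
  have hneg : ∑ i, g i * (l (cubePoint i.1) - l (cubePoint x)) < ∑ _i : s, (0 : ℝ) := by
    refine Finset.sum_lt_sum (fun z _ => ?_) ⟨i, Finset.mem_univ _, ?_⟩
    · by_cases hz : 0 < g z
      · exact mul_nonpos_of_nonneg_of_nonpos hz.le (by linarith [(hiff z).2 hz])
      · refine mul_nonpos_of_nonpos_of_nonneg (not_lt.1 hz) ?_
        have := mt (hiff z).1 hz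
        linarith
    · exact mul_neg_of_pos_of_neg hi (by linarith [(hiff i).2 hi])
  rw [h0, Finset.sum_const_zero] at hneg
  exact hneg.false

/-- Sauer–Shelah, with each binomial coefficient bounded crudely by `(2 ^ n) ^ n`. -/
theorem card_halfspaceTraces_le {n : ℕ} (x : Fin n → Bool) :
    (halfspaceTraces x).card ≤ (n + 1) * (2 ^ n) ^ n := by
  classical
  have hvc : (halfspaceTraces x).vcDim ≤ n := Finset.sup_le fun s hs =>
    card_le_of_shatters_halfspaceTraces (Finset.mem_shatterer.1 hs)
  calc (halfspaceTraces x).card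
      ≤ ∑ k ∈ Finset.Iic (halfspaceTraces x).vcDim, (Fintype.card (Fin n → Bool)).choose k :=
        (Finset.card_le_card_shatterer _).trans Finset.card_shatterer_le_sum_vcDim
    _ ≤ ∑ k ∈ Finset.Iic n, (Fintype.card (Fin n → Bool)).choose k :=
        Finset.sum_le_sum_of_subset (Finset.Iic_subset_Iic.2 hvc)
    _ ≤ ∑ k ∈ Finset.Iic n, (2 ^ n) ^ n := by
        refine Finset.sum_le_sum fun k hk => ?_
        rw [Fintype.card_fun, Fintype.card_bool, Fintype.card_fin]
        exact (Nat.choose_le_pow _ _).trans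
          (Nat.pow_le_pow_right (by positivity) (Finset.mem_Iic.1 hk))
    _ = _ := by simp

/-! ### Subcubes and the probability that a given pair is bad. -/

open scoped Classical in
theorem card_filter_subcube {n : ℕ} (x y : Fin n → Bool) :
    (Finset.univ.filter (· ∈ subcube x y)).card = 2 ^ hammingDist x y := by
  have : Finset.univ.filter (· ∈ subcube x y)
      = Fintype.piFinset fun i => if x i = y i then {x i} else Finset.univ := by
    ext z
    rw [Finset.mem_filter, Fintype.mem_piFinset]
    simp only [Finset.mem_univ, true_and]
    refine forall_congr' fun i => ?_
    split_ifs with h <;> simp [h]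
  rw [this, Fintype.card_piFinset]
  simp only [apply_ite Finset.card, Finset.card_singleton, Finset.card_univ, Fintype.card_bool,
    Finset.prod_ite, Finset.prod_const, one_pow, one_mul]
  rfl

/-- The reflection through the centre of the subcube of `x` and `y`. -/
def subcubeReflect {n : ℕ} (x y z : Fin n → Bool) : Fin n → Bool :=
  fun i => x i ^^ (y i ^^ z i)

theorem cubePoint_subcubeReflect {n : ℕ} {x y z : Fin n → Bool} (hz : z ∈ subcube x y) :
    cubePoint (subcubeReflect x y z) = cubePoint x + cubePoint y - cubePoint z := by
  funext i
  have := hz i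
  simp only [cubePoint, subcubeReflect, Pi.add_apply, Pi.sub_apply]
  rcases Bool.eq_false_or_eq_true (x i) with hx | hx <;>
    rcases Bool.eq_false_or_eq_true (y i) with hy | hy <;>
      rcases Bool.eq_false_or_eq_true (z i) with hz' | hz' <;> simp_all

-- Reflection sends `z` to `x + y - z`, where `l` equals `2 * l x - l z`. Hence the part of the
-- subcube strictly below level `l x` injects into the rest.
open scoped Classical in
theorem two_pow_hammingDist_le {n : ℕ} {x y : Fin n → Bool} (l : StrongDual ℝ (Fin n → ℝ))
    (h : l (cubePoint x) = l (cubePoint y)) :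
    2 ^ hammingDist x y ≤ 2 * (Finset.univ.filter fun z => z ∈ subcube x y ∧
      ¬ l (cubePoint z) < l (cubePoint x)).card := by
  rw [← card_filter_subcube, two_mul, ← Finset.card_filter_add_card_filter_not
    (s := Finset.univ.filter (· ∈ subcube x y)) (fun z => l (cubePoint z) < l (cubePoint x)),
    Finset.filter_filter, Finset.filter_filter]
  refine Nat.add_le_add_right ?_ _
  refine Finset.card_le_card_of_injOn (subcubeReflect x y) ?_ ?_
  · intro z hz
    simp only [Finset.coe_filter, Finset.mem_univ, true_and, Set.mem_ofPred_eq] at hz ⊢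
    refine ⟨fun i hi => by simpa [subcubeReflect, hi] using hz.1 i hi, ?_⟩
    rw [cubePoint_subcubeReflect hz.1]
    simp only [map_add, map_sub]
    linarith [hz.2]
  · intro z _ z' _ hzz
    funext i
    have := congrFun hzz i
    simpa [subcubeReflect] using this

/-- The sets of points avoided by `Q` when a linear functional separates `x` and `y` from the
rest of `Q`. -/
noncomputable def avoidedSets {n : ℕ} (x y : Fin n → Bool) : Finset (Finset (Fin n → Bool)) :=
  open scoped Classical in
  ((halfspaceTraces x).image fun A => Aᶜ \ {x, y}).filter
    fun T => 2 ^ hammingDist x y ≤ 2 * (T.card + 2)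

theorem exists_avoidedSets_of_linearlySeparated {n : ℕ} {Q : Set (Fin n → Bool)}
    {x y : Fin n → Bool} (h : LinearlySeparated Q x y) :
    ∃ T ∈ avoidedSets x y, ∀ z ∈ T, z ∉ Q := by
  classical
  obtain ⟨l, hl, hlt⟩ := h
  set A : Finset (Fin n → Bool) :=
    Finset.univ.filter fun z => l (cubePoint z) < l (cubePoint x) with hA
  refine ⟨Aᶜ \ {x, y}, ?_, ?_⟩
  · unfold avoidedSets
    rw [Finset.mem_filter]
    constructor
    · refine Finset.mem_image.2 ⟨A, ?_, by congr!⟩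
      simp only [halfspaceTraces, Finset.mem_filter, Finset.mem_univ, true_and]
      exact ⟨l, fun z => by simp [hA]⟩
    · refine (two_pow_hammingDist_le l hl).trans ?_
      gcongr
      have h2 : ({x, y} : Finset (Fin n → Bool)).card ≤ 2 := Finset.card_le_two
      have h3 := Finset.le_card_sdiff {x, y} Aᶜ
      have h4 : (Finset.univ.filter fun z => z ∈ subcube x y ∧
          ¬ l (cubePoint z) < l (cubePoint x)).card ≤ Aᶜ.card := by
        refine Finset.card_le_card fun z => ?_
        simp +contextual [hA]
      omega
  · intro z hz hzQ
    simp only [Finset.mem_sdiff, Finset.mem_compl, Finset.mem_insert, Finset.mem_singleton,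
      not_or, hA, Finset.mem_filter, Finset.mem_univ, true_and] at hz
    exact hz.1 (hlt z hzQ hz.2.1 hz.2.2)

open MeasureTheory ProbabilityTheory

/-- Union bound over the candidate avoided sets, each disjoint from `{x, y}`, so that containing
`x`, `y` and avoiding the set are independent. Excluding `x` and `y` costs at most two points, hence
at most `2 * p ≤ 2` in the exponent. -/
theorem real_linearlySeparated_le {n : ℕ} (p : unitInterval) {x y : Fin n → Bool} (hxy : x ≠ y) :
    (setBernoulli Set.univ p).real {Q : Set (Fin n → Bool) |
      x ∈ Q ∧ y ∈ Q ∧ x ≠ y ∧ LinearlySeparated Q x y} ≤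
      (p : ℝ) ^ 2 * (((n + 1) * (2 ^ n) ^ n : ℕ) *
        Real.exp (2 - (p : ℝ) * 2 ^ hammingDist x y / 2)) := by
  classical
  have hp0 := p.2.1
  have hp1 := p.2.2
  calc _ ≤ (setBernoulli Set.univ p).real (⋃ T ∈ avoidedSets x y,
        {Q : Set (Fin n → Bool) | (∀ z ∈ ({x, y} : Finset _), z ∈ Q) ∧ ∀ z ∈ T, z ∉ Q}) := by
        refine measureReal_mono (fun Q hQ => ?_) (measure_ne_top _ _)
        obtain ⟨hx, hy, -, hl⟩ := hQ
        obtain ⟨T, hT, hTQ⟩ := exists_avoidedSets_of_linearlySeparated hl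
        simp only [Set.mem_iUnion]
        exact ⟨T, hT, by simp [hx, hy], hTQ⟩
    _ ≤ ∑ T ∈ avoidedSets x y, (setBernoulli Set.univ p).real
        {Q : Set (Fin n → Bool) | (∀ z ∈ ({x, y} : Finset _), z ∈ Q) ∧ ∀ z ∈ T, z ∉ Q} :=
        measureReal_biUnion_finset_le _ _
    _ ≤ ∑ T ∈ avoidedSets x y,
        (p : ℝ) ^ 2 * Real.exp (2 - (p : ℝ) * 2 ^ hammingDist x y / 2) := by
        refine Finset.sum_le_sum fun T hT => ?_
        obtain ⟨hT1, hT2⟩ := Finset.mem_filter.1 hT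
        obtain ⟨A, -, rfl⟩ := Finset.mem_image.1 hT1
        rw [setBernoulli_real_superset_avoid p _ _ (by
          rw [Finset.disjoint_left]
          intro z hz hz'
          exact (Finset.mem_sdiff.1 hz').2 (by convert hz)), Finset.card_pair hxy]
        gcongr
        have h1 : (1 - p : ℝ) ≤ Real.exp (-p) := by
          have := Real.add_one_le_exp (-(p : ℝ)); linarith
        refine (pow_le_pow_left₀ (by linarith) h1 _).trans ?_
        rw [← Real.exp_nat_mul]
        refine Real.exp_le_exp.2 ?_
        have h2 : (2 : ℝ) ^ hammingDist x y ≤ 2 * (((Aᶜ \ {x, y}).card : ℝ) + 2) := by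
          exact_mod_cast hT2
        have h3 := mul_le_mul_of_nonneg_left h2 hp0
        linarith
    _ = (avoidedSets x y).card *
        ((p : ℝ) ^ 2 * Real.exp (2 - (p : ℝ) * 2 ^ hammingDist x y / 2)) := by
        rw [Finset.sum_const, nsmul_eq_mul]
    _ ≤ ((n + 1) * (2 ^ n) ^ n : ℕ) *
        ((p : ℝ) ^ 2 * Real.exp (2 - (p : ℝ) * 2 ^ hammingDist x y / 2)) := by
        gcongr
        exact (Finset.card_filter_le _ _).trans (Finset.card_image_le.trans
          (card_halfspaceTraces_le x))
    _ = _ := by ring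

theorem real_subcubeMeets_le {n : ℕ} (p : unitInterval) {x y : Fin n → Bool} (hxy : x ≠ y) :
    (setBernoulli Set.univ p).real {Q : Set (Fin n → Bool) |
      x ∈ Q ∧ y ∈ Q ∧ x ≠ y ∧ SubcubeMeets Q x y} ≤ (p : ℝ) ^ 2 * (p * 2 ^ hammingDist x y) := by
  classical
  have hp0 := p.2.1
  set F := (Finset.univ.filter (· ∈ subcube x y)) \ {x, y} with hF
  calc _ ≤ (setBernoulli Set.univ p).real (⋃ z ∈ F,
        {Q : Set (Fin n → Bool) | (∀ w ∈ ({x, y, z} : Finset _), w ∈ Q) ∧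
          ∀ w ∈ (∅ : Finset _), w ∉ Q}) := by
        refine measureReal_mono (fun Q hQ => ?_) (measure_ne_top _ _)
        obtain ⟨hx, hy, -, z, hzx, hzy, hz, hzQ⟩ := hQ
        simp only [Set.mem_iUnion]
        exact ⟨z, by simp [hF, hzx, hzy, hz], by simp [hx, hy, hzQ]⟩
    _ ≤ ∑ z ∈ F, (setBernoulli Set.univ p).real
        {Q : Set (Fin n → Bool) | (∀ w ∈ ({x, y, z} : Finset _), w ∈ Q) ∧
          ∀ w ∈ (∅ : Finset _), w ∉ Q} :=
        measureReal_biUnion_finset_le _ _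
    _ = ∑ z ∈ F, (p : ℝ) ^ 3 := by
        refine Finset.sum_congr rfl fun z hz => ?_
        simp only [hF, Finset.mem_sdiff, Finset.mem_insert, Finset.mem_singleton, not_or] at hz
        rw [setBernoulli_real_superset_avoid p _ _ (Finset.disjoint_empty_right _),
          Finset.card_eq_three.2 ⟨x, y, z, hxy, Ne.symm hz.2.1, Ne.symm hz.2.2, rfl⟩]
        simp
    _ = F.card * (p : ℝ) ^ 3 := by rw [Finset.sum_const, nsmul_eq_mul]
    _ ≤ (2 : ℝ) ^ hammingDist x y * (p : ℝ) ^ 3 := by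
        gcongr
        have : F.card ≤ 2 ^ hammingDist x y := by
          rw [← card_filter_subcube]
          exact Finset.card_le_card Finset.sdiff_subset
        exact_mod_cast this
    _ = _ := by ring

/-! ### Concentration of the Hamming distance around `n / 2`. -/

/-- The distance to a uniform point is binomial with parameters `n` and `1 / 2`; its variance is
read off from the Bernstein polynomial identity at `1 / 2`. -/
theorem sum_hammingDist_sub_sq {n : ℕ} (x : Fin n → Bool) :
    ∑ y : Fin n → Bool, ((hammingDist x y : ℝ) - n / 2) ^ 2 = (2 : ℝ) ^ n * (n / 4) := by
  classical
  let e : (Fin n → Bool) ≃ Finset (Fin n) :=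
    { toFun := fun y => Finset.univ.filter fun i => x i ≠ y i
      invFun := fun s i => if i ∈ s then !x i else x i
      left_inv := fun y => by
        funext i
        simp only [Finset.mem_filter, Finset.mem_univ, true_and]
        cases x i <;> cases y i <;> simp
      right_inv := fun s => by
        ext i
        by_cases h : i ∈ s <;> simp [h] }
  have h1 : ∑ y : Fin n → Bool, ((hammingDist x y : ℝ) - n / 2) ^ 2
      = ∑ s : Finset (Fin n), ((s.card : ℝ) - n / 2) ^ 2 :=
    Fintype.sum_equiv e _ _ fun y => rfl
  rw [h1, ← Finset.powerset_univ,
    Finset.sum_powerset_apply_card (fun k : ℕ => ((k : ℝ) - n / 2) ^ 2), Finset.card_univ,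
    Fintype.card_fin]
  have hv := congrArg (Polynomial.eval (1 / 2 : ℝ)) (bernsteinPolynomial.variance ℝ n)
  simp only [Polynomial.eval_finsetSum, Polynomial.eval_mul, Polynomial.eval_pow,
    Polynomial.eval_sub, bernsteinPolynomial, Polynomial.eval_X,
    Polynomial.eval_natCast, Polynomial.eval_one, nsmul_eq_mul] at hv
  have h2 : (2 : ℝ) ^ n * (n / 4) = 2 ^ n * (n * (1 / 2) * (1 - 1 / 2)) := by ring
  rw [h2, ← hv, Finset.mul_sum]
  refine Finset.sum_congr rfl fun k hk => ?_
  have hk' : k ≤ n := by simpa [Nat.lt_succ_iff] using hk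
  have h3 : (2 : ℝ) ^ n * ((1 / 2) ^ k * (1 - 1 / 2) ^ (n - k)) = 1 := by
    rw [show (1 - 1 / 2 : ℝ) = 1 / 2 by norm_num, ← pow_add, Nat.add_sub_cancel' hk', ← mul_pow]
    norm_num
  rw [nsmul_eq_mul]
  linear_combination (-(n.choose k : ℝ) * (k - n / 2) ^ 2) * h3

open scoped Classical in
theorem card_hammingDist_far_le {n : ℕ} (hn : 0 < n) {δ : ℝ} (hδ : 0 < δ) (x : Fin n → Bool) :
    ((Finset.univ.filter fun y => δ * n ≤ |(hammingDist x y : ℝ) - n / 2|).card : ℝ)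
      ≤ 2 ^ n * (1 / (4 * δ ^ 2 * n)) := by
  have hn' : (0 : ℝ) < n := by exact_mod_cast hn
  have h1 : ((Finset.univ.filter fun y => δ * n ≤ |(hammingDist x y : ℝ) - n / 2|).card : ℝ)
      * (δ * n) ^ 2 ≤ 2 ^ n * (n / 4) := by
    rw [← sum_hammingDist_sub_sq x, ← nsmul_eq_mul]
    refine (Finset.card_nsmul_le_sum _ _ _ fun y hy => ?_).trans
      (Finset.sum_le_sum_of_subset_of_nonneg (Finset.filter_subset _ _)
        fun _ _ _ => sq_nonneg _)
    rw [← sq_abs ((hammingDist x y : ℝ) - n / 2)]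
    exact pow_le_pow_left₀ (by positivity) (Finset.mem_filter.1 hy).2 2
  rw [← le_div_iff₀ (by positivity)] at h1
  refine h1.trans_eq ?_
  field_simp

namespace RandomSubset
open MeasureTheory ProbabilityTheory

/-- If `R` holds with conditional probability at most `η` for pairs at Hamming distance close to
`n / 2`, then the expected number of `R`-pairs is a small proportion of all pairs. -/
theorem sum_real_pairs_le {n : ℕ} (hn : 0 < n) {δ η : ℝ} (hδ : 0 < δ) (hη : 0 ≤ η)
    (p : unitInterval)
    (R : Set (Fin n → Bool) → (Fin n → Bool) → (Fin n → Bool) → Prop)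
    (hR : ∀ x y, x ≠ y → |(hammingDist x y : ℝ) - n / 2| < δ * n →
      (setBernoulli Set.univ p).real {Q : Set (Fin n → Bool) | x ∈ Q ∧ y ∈ Q ∧ x ≠ y ∧ R Q x y}
        ≤ (p : ℝ) ^ 2 * η) :
    ∑ q : (Fin n → Bool) × (Fin n → Bool), (setBernoulli Set.univ p).real
      {Q : Set (Fin n → Bool) | q.1 ∈ Q ∧ q.2 ∈ Q ∧ q.1 ≠ q.2 ∧ R Q q.1 q.2}
      ≤ (1 / (4 * δ ^ 2 * n) + η) * ((p : ℝ) * Fintype.card (Fin n → Bool)) ^ 2 := by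
  classical
  have hb : ∀ x y : Fin n → Bool, (setBernoulli Set.univ p).real
      {Q : Set (Fin n → Bool) | x ∈ Q ∧ y ∈ Q ∧ x ≠ y ∧ R Q x y}
      ≤ (p : ℝ) ^ 2 * (if δ * n ≤ |(hammingDist x y : ℝ) - n / 2| then 1 else 0)
        + (p : ℝ) ^ 2 * η := by
    intro x y
    have h0 : 0 ≤ (p : ℝ) ^ 2 * η := by positivity
    by_cases hxy : x = y
    · have : {Q : Set (Fin n → Bool) | x ∈ Q ∧ y ∈ Q ∧ x ≠ y ∧ R Q x y} = ∅ := by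
        ext Q; simp [hxy]
      rw [this, measureReal_empty]
      positivity
    split_ifs with h
    · have : (setBernoulli Set.univ p).real
          {Q : Set (Fin n → Bool) | x ∈ Q ∧ y ∈ Q ∧ x ≠ y ∧ R Q x y} ≤ (p : ℝ) ^ 2 := by
        rw [← real_mem_mem p hxy]
        exact measureReal_mono fun Q hQ => ⟨hQ.1, hQ.2.1⟩
      linarith
    · have := hR x y hxy (not_le.1 h)
      linarith
  rw [Fintype.sum_prod_type]
  calc _ ≤ ∑ x : Fin n → Bool, ∑ y : Fin n → Bool,
        ((p : ℝ) ^ 2 * (if δ * n ≤ |(hammingDist x y : ℝ) - n / 2| then 1 else 0)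
        + (p : ℝ) ^ 2 * η) := Finset.sum_le_sum fun x _ => Finset.sum_le_sum fun y _ => hb x y
    _ ≤ ∑ x : Fin n → Bool,
        ((p : ℝ) ^ 2 * (2 ^ n * (1 / (4 * δ ^ 2 * n))) + 2 ^ n * ((p : ℝ) ^ 2 * η)) := by
        refine Finset.sum_le_sum fun x _ => ?_
        rw [Finset.sum_add_distrib, ← Finset.mul_sum, Finset.sum_const, Finset.card_univ,
          Fintype.card_fun, Fintype.card_bool, Fintype.card_fin, nsmul_eq_mul, Finset.sum_boole]
        push_cast
        have := card_hammingDist_far_le hn hδ x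
        gcongr
    _ = _ := by
        rw [Finset.sum_const, Finset.card_univ,
          Fintype.card_fun, Fintype.card_bool, Fintype.card_fin, nsmul_eq_mul]
        push_cast
        ring

end RandomSubset

/-! ### Asymptotics and the two regimes. -/

open MeasureTheory ProbabilityTheory Filter Topology

namespace RandomSubset

theorem exists_tendsto_real_pairs (p : ℕ → unitInterval)
    (R : ∀ n, Set (Fin n → Bool) → (Fin n → Bool) → (Fin n → Bool) → Prop)
    {η : ℕ → ℝ} (hη : ∀ n, 0 ≤ η n) (hη0 : Tendsto η atTop (𝓝 0)) {δ : ℝ} (hδ : 0 < δ)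
    (hR : ∀ᶠ n : ℕ in atTop, ∀ x y : Fin n → Bool, x ≠ y → |(hammingDist x y : ℝ) - n / 2| < δ * n →
      (setBernoulli Set.univ (p n)).real
        {Q : Set (Fin n → Bool) | x ∈ Q ∧ y ∈ Q ∧ x ≠ y ∧ R n Q x y} ≤ (p n : ℝ) ^ 2 * η n) :
    ∃ δ : ℕ → ℝ, (∀ n, 0 ≤ δ n) ∧ Tendsto δ atTop (𝓝 0) ∧
      Tendsto (fun n => (setBernoulli Set.univ (p n)).real
        {Q : Set (Fin n → Bool) | ((pairs (R n) Q).card : ℝ) ≤ δ n * (Q.ncard * (Q.ncard - 1))})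
        atTop (𝓝 1) := by
  have hinv : Tendsto (fun n : ℕ => 1 / (4 * δ ^ 2 * n) + η n) atTop (𝓝 0) := by
    have h := (tendsto_const_div_atTop_nhds_zero_nat (1 / (4 * δ ^ 2))).add hη0
    rw [add_zero] at h
    exact h.congr fun n => by rw [div_div]
  -- The fourth root matches the `θ ^ 4` in the hypothesis of `real_card_pairs_le`.
  set θ : ℕ → ℝ := fun n => √√(1 / (4 * δ ^ 2 * n) + η n) with hθdef
  have hθ : Tendsto θ atTop (𝓝 0) := by
    have := hinv.sqrt.sqrt
    rwa [Real.sqrt_zero, Real.sqrt_zero] at this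
  have hθ4 : ∀ n, θ n ^ 4 = 1 / (4 * δ ^ 2 * n) + η n := fun n => by
    have h0 : 0 ≤ 1 / (4 * δ ^ 2 * n) + η n := add_nonneg (by positivity) (hη n)
    rw [hθdef, show (4 : ℕ) = 2 * 2 by rfl, pow_mul, Real.sq_sqrt (Real.sqrt_nonneg _),
      Real.sq_sqrt h0]
  refine ⟨fun n => 8 * θ n ^ 2, fun n => by positivity, by simpa using (hθ.pow 2).const_mul 8, ?_⟩
  have hlow : Tendsto (fun n => 1 - (4 * θ n + θ n ^ 2)) atTop (𝓝 1) := by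
    simpa using ((hθ.const_mul 4).add (hθ.pow 2)).const_sub 1
  refine tendsto_of_tendsto_of_tendsto_of_le_of_le' hlow tendsto_const_nhds ?_
    (Eventually.of_forall fun n => measureReal_le_one)
  filter_upwards [hR, hθ.eventually_le_const (by norm_num : (0 : ℝ) < 1 / 4),
    eventually_gt_atTop 0] with n hRn hθn hn
  refine real_card_pairs_le (p n) (R n) rfl (Real.sqrt_nonneg _) hθn ?_
  rw [hθ4]
  exact sum_real_pairs_le hn hδ (hη n) (p n) (R n) hRn

theorem tendsto_real_one_lt_ncard (p : ℕ → unitInterval) {s : ℝ} (hs : 1 < s)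
    (hp : ∀ᶠ n in atTop, s ^ n ≤ (p n : ℝ) * 2 ^ n) :
    Tendsto (fun n => (setBernoulli Set.univ (p n)).real
      {Q : Set (Fin n → Bool) | ¬ 1 < Q.ncard}) atTop (𝓝 0) := by
  have hpow := tendsto_pow_atTop_atTop_of_one_lt hs
  refine tendsto_of_tendsto_of_tendsto_of_le_of_le' tendsto_const_nhds
    (hpow.const_div_atTop 4) (Eventually.of_forall fun n => measureReal_nonneg) ?_
  filter_upwards [hp, hpow.eventually_ge_atTop 4] with n hn hn4
  have hcard : (p n : ℝ) * 2 ^ n = p n * Fintype.card (Fin n → Bool) := by simp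
  refine (measureReal_mono (s₂ := {Q : Set (Fin n → Bool) | (Q.ncard : ℝ) < (p n * 2 ^ n) / 2})
    fun Q hQ => ?_).trans ((real_ncard_lt_le (p n) hcard (by linarith)).trans ?_)
  · simp only [Set.mem_ofPred_eq, not_lt] at hQ ⊢
    have : (Q.ncard : ℝ) ≤ 1 := by exact_mod_cast hQ
    linarith
  · gcongr

end RandomSubset

/-- The gap `ε` leaves room for distances deviating from `n / 2` by up to `δ * n`, which change the
subcube size by a factor of at most `2 ^ (δ * n)`. -/
theorem exists_pos_mul_rpow_lt_one {a : ℝ} (ha : a < 1) : ∃ δ : ℝ, 0 < δ ∧ a * 2 ^ δ < 1 := by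
  have hc : ContinuousAt (fun δ : ℝ => a * (2 : ℝ) ^ δ) 0 :=
    continuousAt_const.mul (Real.continuousAt_const_rpow (by norm_num))
  have h := hc.eventually_lt_const (by simpa using ha)
  obtain ⟨δ, h1, h2⟩ := ((h.filter_mono nhdsWithin_le_nhds).and self_mem_nhdsWithin :
    ∀ᶠ δ : ℝ in 𝓝[>] 0, _ ∧ δ ∈ Set.Ioi 0).exists
  exact ⟨δ, h2, h1⟩

theorem exists_pos_one_lt_mul_rpow {a : ℝ} (ha : 1 < a) : ∃ δ : ℝ, 0 < δ ∧ 1 < a * 2 ^ (-δ) := by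
  have hc : ContinuousAt (fun δ : ℝ => a * (2 : ℝ) ^ (-δ)) 0 :=
    continuousAt_const.mul ((Real.continuous_const_rpow (by norm_num)).comp
      continuous_neg).continuousAt
  have h := hc.eventually_const_lt (by simpa using ha)
  obtain ⟨δ, h1, h2⟩ := ((h.filter_mono nhdsWithin_le_nhds).and self_mem_nhdsWithin :
    ∀ᶠ δ : ℝ in 𝓝[>] 0, _ ∧ δ ∈ Set.Ioi 0).exists
  exact ⟨δ, h2, h1⟩

theorem div_sqrt_two_pow_mul_rpow (a δ : ℝ) (n : ℕ) :
    (a / √2) ^ n * (2 : ℝ) ^ ((n : ℝ) / 2 + δ * n) = (a * 2 ^ δ) ^ n := by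
  have h2 : (0 : ℝ) < 2 := by norm_num
  have h : (2 : ℝ) ^ ((n : ℝ) / 2 + δ * n) = (√2 * 2 ^ δ) ^ n := by
    rw [Real.sqrt_eq_rpow, ← Real.rpow_add h2, ← Real.rpow_natCast, ← Real.rpow_mul h2.le]
    congr 1
    ring
  rw [h, ← mul_pow]
  congr 1
  field_simp

theorem tendsto_pow_mul_exp_sub_pow {r : ℝ} (hr : 1 < r) :
    Tendsto (fun n : ℕ => (((n + 1) * (2 ^ n) ^ n : ℕ) : ℝ) * Real.exp (2 - r ^ n / 2))
      atTop (𝓝 0) := by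
  have hpow := tendsto_pow_atTop_atTop_of_one_lt hr
  have hexp : Tendsto (fun n : ℕ => Real.exp (2 - r ^ n / 4)) atTop (𝓝 0) := by
    refine Real.tendsto_exp_atBot.comp (tendsto_atBot_add_const_left _ 2 ?_)
    exact tendsto_neg_atTop_atBot.comp (hpow.atTop_div_const (by norm_num))
  refine tendsto_of_tendsto_of_tendsto_of_le_of_le' tendsto_const_nhds hexp
    (Eventually.of_forall fun n => by positivity) ?_
  -- With `n ^ 2 ≤ r ^ n / 8`, the exponent `n + n ^ 2 ≤ 2 * n ^ 2` of the polynomial and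
  -- trace-count factors uses up only half of `r ^ n / 2`.
  have hq := (tendsto_pow_const_div_const_pow_of_one_lt 2 hr).eventually_le_const
    (by norm_num : (0 : ℝ) < 1 / 8)
  filter_upwards [hq] with n hn
  rw [div_le_iff₀ (by positivity)] at hn
  have h1 : (n : ℝ) + 1 ≤ Real.exp n := Real.add_one_le_exp _
  have h2 : ((2 : ℝ) ^ n) ^ n ≤ Real.exp ((n : ℝ) ^ 2) := by
    have : (2 : ℝ) ≤ Real.exp 1 := by
      have := Real.add_one_le_exp (1 : ℝ); linarith
    calc ((2 : ℝ) ^ n) ^ n ≤ (Real.exp 1 ^ n) ^ n := by gcongr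
      _ = Real.exp ((n : ℝ) ^ 2) := by
        rw [← Real.exp_nat_mul, ← Real.exp_nat_mul]; congr 1; ring
  have h3 : (n : ℝ) ≤ (n : ℝ) ^ 2 := by exact_mod_cast Nat.le_self_pow (by norm_num) n
  push_cast
  calc ((n : ℝ) + 1) * (2 ^ n) ^ n * Real.exp (2 - r ^ n / 2)
      ≤ Real.exp n * Real.exp ((n : ℝ) ^ 2) * Real.exp (2 - r ^ n / 2) := by gcongr
    _ = Real.exp (n + (n : ℝ) ^ 2 + (2 - r ^ n / 2)) := by rw [Real.exp_add, Real.exp_add]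
    _ ≤ Real.exp (2 - r ^ n / 4) := Real.exp_le_exp.2 (by linarith)

theorem exists_tendsto_abs_one_sub_graphDensity (ε : ℝ) (p : ℕ → unitInterval) (hε : 0 < ε)
    (hp : ∀ᶠ n in atTop, (p n : ℝ) ≤ ((1 - ε) / √2) ^ n) :
    ∃ δ : ℕ → ℝ, Tendsto δ atTop (𝓝 0) ∧
      Tendsto (fun n => (randomCubeSubset n (p n)).real
        {Q | |1 - graphDensity (polytopeGraph (zeroOnePolytope Q))| ≤ δ n}) atTop (𝓝 1) := by
  -- For `ε > 1` the bound on `p` is negative at odd `n`, so the hypothesis cannot hold.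
  have hε1 : 0 ≤ 1 - ε := by
    by_contra! hneg
    obtain ⟨N, hN⟩ := eventually_atTop.1 hp
    have h1 := hN (2 * N + 1) (by omega)
    have h2 : ((1 - ε) / √2) ^ (2 * N + 1) < 0 :=
      Odd.pow_neg ⟨N, rfl⟩ (div_neg_of_neg_of_pos hneg (by positivity))
    linarith [(p (2 * N + 1)).2.1]
  obtain ⟨δ, hδ, hr⟩ := exists_pos_mul_rpow_lt_one (by linarith : 1 - ε < 1)
  have hr0 : 0 ≤ (1 - ε) * (2 : ℝ) ^ δ := by positivity
  obtain ⟨d, hd, hd0, hlim⟩ := RandomSubset.exists_tendsto_real_pairs p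
    (fun n => SubcubeMeets) (fun n => pow_nonneg hr0 n) (tendsto_pow_atTop_nhds_zero_of_lt_one hr0 hr)
    hδ (by
      filter_upwards [hp] with n hn x y hxy hdist
      refine (real_subcubeMeets_le (p n) hxy).trans ?_
      gcongr
      rw [← div_sqrt_two_pow_mul_rpow, ← Real.rpow_natCast]
      refine mul_le_mul hn (Real.rpow_le_rpow_of_exponent_le (by norm_num) ?_) (by positivity)
        (by positivity)
      linarith [(abs_lt.1 hdist).2])
  refine ⟨d, hd0, tendsto_of_tendsto_of_tendsto_of_le_of_le hlim tendsto_const_nhds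
    (fun n => ?_) fun n => ?_⟩
  · exact measureReal_mono (fun Q hQ => abs_one_sub_graphDensity_le (hd n) hQ) (measure_ne_top _ _)
  · exact measureReal_le_one (μ := setBernoulli _ _)

theorem exists_tendsto_abs_graphDensity (ε : ℝ) (p : ℕ → unitInterval) (hε : 0 < ε)
    (hp : ∀ᶠ n in atTop, ((1 + ε) / √2) ^ n ≤ (p n : ℝ)) :
    ∃ δ : ℕ → ℝ, Tendsto δ atTop (𝓝 0) ∧
      Tendsto (fun n => (randomCubeSubset n (p n)).real
        {Q | |graphDensity (polytopeGraph (zeroOnePolytope Q))| ≤ δ n}) atTop (𝓝 1) := by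
  obtain ⟨δ, hδ, hr⟩ := exists_pos_one_lt_mul_rpow (by linarith : 1 < 1 + ε)
  obtain ⟨d, hd, hd0, hlim⟩ := RandomSubset.exists_tendsto_real_pairs p
    (fun n => LinearlySeparated) (fun n => by positivity) (tendsto_pow_mul_exp_sub_pow hr)
    hδ (by
      filter_upwards [hp] with n hn x y hxy hdist
      refine (real_linearlySeparated_le (p n) hxy).trans ?_
      have : ((1 + ε) * (2 : ℝ) ^ (-δ)) ^ n ≤ p n * 2 ^ hammingDist x y := by
        rw [← div_sqrt_two_pow_mul_rpow, ← Real.rpow_natCast 2 (hammingDist x y)]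
        refine mul_le_mul hn (Real.rpow_le_rpow_of_exponent_le (by norm_num) ?_) (by positivity)
          (p n).2.1
        linarith [(abs_lt.1 hdist).1]
      gcongr)
  -- Density `1` is the convention for at most one vertex, so `1 < Q.ncard` is needed with high
  -- probability; here the mean `p * 2 ^ n` is at least `((1 + ε) * √2) ^ n`.
  have hs : 1 < (1 + ε) * √2 := by
    have : 1 < √2 := Real.lt_sqrt_of_sq_lt (by norm_num)
    nlinarith
  have hcard := RandomSubset.tendsto_real_one_lt_ncard p hs (by
    filter_upwards [hp] with n hn
    have h2 : (1 + ε) * √2 = (1 + ε) / √2 * 2 := by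
      have : √2 * √2 = 2 := Real.mul_self_sqrt (by norm_num)
      field_simp
      linarith
    rw [h2, mul_pow]
    gcongr)
  have hlow := hlim.sub hcard
  rw [sub_zero] at hlow
  refine ⟨d, hd0, tendsto_of_tendsto_of_tendsto_of_le_of_le hlow tendsto_const_nhds
    (fun n => ?_) fun n => ?_⟩
  · rw [sub_le_iff_le_add]
    refine (measureReal_mono (fun Q hQ => ?_) (measure_ne_top _ _)).trans
      (measureReal_union_le _ _)
    by_cases h : 1 < Q.ncard
    · exact Or.inl (abs_graphDensity_le h hQ)
    · exact Or.inr h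
  · exact measureReal_le_one (μ := setBernoulli _ _)

theorem theorem1 (ε : ℝ) (hε : 0 < ε) (p : ℕ → unitInterval) :
    ((∀ᶠ n in Filter.atTop, (p n : ℝ) ≤ ((1 - ε) / Real.sqrt 2) ^ n) →
      ∃ δ : ℕ → ℝ, Filter.Tendsto δ Filter.atTop (nhds 0) ∧
        Filter.Tendsto
          (fun n => (randomCubeSubset n (p n)).real
            {Q | |1 - graphDensity (polytopeGraph (zeroOnePolytope Q))| ≤ δ n})
          Filter.atTop (nhds 1)) ∧
    ((∀ᶠ n in Filter.atTop, ((1 + ε) / Real.sqrt 2) ^ n ≤ (p n : ℝ)) →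
      ∃ δ : ℕ → ℝ, Filter.Tendsto δ Filter.atTop (nhds 0) ∧
        Filter.Tendsto
          (fun n => (randomCubeSubset n (p n)).real
            {Q | |graphDensity (polytopeGraph (zeroOnePolytope Q))| ≤ δ n})
          Filter.atTop (nhds 1)) :=
  ⟨exists_tendsto_abs_one_sub_graphDensity ε p hε, exists_tendsto_abs_graphDensity ε p hε⟩
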